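/- Let $N\ge 1$, $T\ge 2$, let $E_n,\ \underline x_{n,t}\, ,\ \overline x_{n,t},\ p_t$ be real numbers ($1\le n\le N$, $1\le t\le T$) and put $$X_n=\Big\{x\in\mathbb R^T:\ \sum_t x_t=E_n,\ \underline x_{n,t}\le x_t\le\overline x_{n,t}\ \forall t\Big\},\quad X=\prod_n X_n,\quad Y=\Big\{y\in\mathbb R^{N\times T}:\ \sum_n y_{n,t}=p_t\ \forall t\Big\}.$$ Assume $X\neq\emptyset$ and $\sum_t p_t=\sum_n E_n$. Let $\|\cdot\|$ be a norm on $\mathbb R^{N\times T}$, $\varepsilon_{\rm cvg}>0$, $\varepsilon_{\rm dis}>0$, $y^{(0)}\in\mathbb R^{N\times T}$, let $$\rho_{NT}=1-\frac{4}{N(T+1)^2(T-1)}$$ and let $B>(1-\rho_{NT})^{-1}$. Let $P_C$ denote the Euclidean projection onto $C$. The algorithm NI-APM starts with $k=0$ and repeats the following pass: each agent $n$ computes $\ell_n^{(k+1)}=P_{X_n}(y_n^{(k)})$; the operator obtains $S^{(k+1)}=\sum_n\ell^{(k+1)}_n$ by secure multiparty summation (each $\ell_{n,t}^{(k+1)}$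 is split into $N$ shares $s_{n,t,m}$, the first $N-1$ drawn at random and the last being the remainder; agent $n$ sends $\sigma_{n,t}=\sum_m s_{m,t,n}$, and $S^{(k+1)}_t=\sum_n\sigma_{n,t}$), and sends $\nu^{(k+1)}=\frac1N(p-S^{(k+1)})$ to the agents; each agent sets $y_n^{(k+1)}=\ell_n^{(k+1)}+\nu^{(k+1)}$; then $k\leftarrow k+1$. The loop of passes is left as soon as $k\ge 2$ and $\|\ell^{(k)}-\ell^{(k-1)}\|<\varepsilon_{\rm cvg}$. At such an exit, if $\|\ell^{(k)}-y^{(k)}\|\le\varepsilon_{\rm dis}$ the algorithm returns DISAG $=$ true and the profile $\ell^{(k)}$. Otherwise let $\mathcal T_0=\{t:\ \nu^{(k)}_t>\frac32B\varepsilon_{\rm cvg}\}$ and $A_{\mathcal T_0}=\sum_{t\in\mathcal T_0}\sum_n\sigma_{n,t}$; if $A_{\mathcal T_0}<\sum_{t\in\mathcal T_0}p_t$ the algorithm returns DISAG $=$ false, $\mathcal T_0$ and $A_{\mathcal T_0}$; otherwise $\varepsilon_{\rm cvg}$ is replaced by $\varepsilon_{\rm cvg}/2$ and the loop is entered again. Then,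 for every realization of the random draws: 1. The algorithm terminates after finitely many passes. 2. If it returns DISAG $=$ true with profile $\ell$, then $\ell\in X$ and $\|\ell-P_Y(\ell)\|\le\varepsilon_{\rm dis}$. If it returns DISAG $=$ false with $\mathcal T_0,A_{\mathcal T_0}$, then $A_{\mathcal T_0}<\sum_{t\in\mathcal T_0}p_t$, and $A_{\mathcal T_0}=\sum_{t\in\mathcal T_0}\sum_n\ell_{n,t}$ for some $\ell\in X$. 3. The infinite alternating projections sequences $\ell^{(k+1)}=P_X(y^{(k)})$, $y^{(k+1)}=P_Y(\ell^{(k+1)})$ started at $y^{(0)}$ converge to some $\ell^\infty\in X$ and $y^\infty\in Y$. Put $\nu^\infty_t=\frac1N(p_t-\sum_n\ell^\infty_{n,t})$ and $\mathcal T_0^\infty=\{t:\nu_t^\infty>0\}$. Suppose in addition that $\|\cdot\|$ is the Frobenius norm. Then: - if $X\cap Y\ne\emptyset$, the algorithm returns DISAG $=$ true; - at every exit of the loop at which the current threshold satisfies $B\varepsilon_{\rm cvg}<\frac25|\nu^\infty_t|$ for all $t$ with $\nu^\infty_t\neq0$, one has $\mathcal T_0=\mathcal T_0^\infty$. If moreover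 $X\cap Y=\emptyset$, then the algorithm returns at this exit, either with DISAG $=$ true or with the set $\mathcal T_0=\mathcal T_0^\infty$ and $A_{\mathcal T_0}$; one has $A_{\mathcal T_0}<\sum_{t\in\mathcal T_0}p_t$; and with $\mathcal N_0=\{n:\ E_n-\sum_{t\notin\mathcal T_0}\underline x_{n,t}-\sum_{t\in\mathcal T_0}\overline x_{n,t}<0\}$, $p$ violates the Hoffman cut of $(\mathcal T_0,\mathcal N_0)$: $$\sum_{n\in\mathcal N_0}E_n-\sum_{t\in\mathcal T_0}p_t+\sum_{t\in\mathcal T_0,\,n\notin\mathcal N_0}\overline x_{n,t}-\sum_{t\notin\mathcal T_0,\,n\in\mathcal N_0}\underline x_{n,t}<0 .$$ -/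

import Mathlib

open Filter Topology

noncomputable section

namespace NIAPM

/-- Profiles `ℓ = (ℓ_{n,t}) ∈ ℝ^{NT}`; the row `ℓ n` is the profile of agent `n`, and the norm of
this space is the Frobenius norm `(∑_{n,t} ℓ_{n,t}^2)^{1/2}`. -/
abbrev Profile (N T : ℕ) : Type := PiLp 2 (fun _ : Fin N => EuclideanSpace ℝ (Fin T))

/-- Data of a disaggregation problem: demands `E n`, bounds `lb n t`, `ub n t`, and the
aggregate allocation `p`. -/
structure Problem (N T : ℕ) where
  E : Fin N → ℝ
  lb : Fin N → Fin T → ℝ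
  ub : Fin N → Fin T → ℝ
  p : Fin T → ℝ

/-- `x` is a point of `C` nearest to `y`. -/
def IsNearest {V : Type*} [NormedAddCommGroup V] (C : Set V) (y x : V) : Prop :=
  x ∈ C ∧ ∀ z ∈ C, ‖y - x‖ ≤ ‖y - z‖

/-- The projection onto `C` (meaningful when `C` is a nonempty closed convex set). -/
def proj {V : Type*} [NormedAddCommGroup V] (C : Set V) (y : V) : V :=
  Classical.epsilon (IsNearest C y)

section Problem

variable {N T : ℕ} (D : Problem N T)

/-- The feasible set `X_n ⊆ ℝ^T` of agent `n`. -/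
def Problem.Xn (n : Fin N) : Set (EuclideanSpace ℝ (Fin T)) :=
  {x | ∑ t, x t = D.E n ∧ ∀ t, D.lb n t ≤ x t ∧ x t ≤ D.ub n t}

/-- The product `X = ∏ X_n`. -/
def Problem.X : Set (Profile N T) := {ℓ | ∀ n, ℓ n ∈ D.Xn n}

/-- The affine space `Y_p` of profiles with aggregate `p`. -/
def Problem.Y : Set (Profile N T) := {y | ∀ t, ∑ n, y n t = D.p t}

/-- The correction `ν = (p - ∑_n ℓ_n) / N`. -/
def Problem.nu (ℓ : Profile N T) (t : Fin T) : ℝ := (1 / (N : ℝ)) * (D.p t - ∑ n, ℓ n t)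

/-- The set `{t | 0 < ν_t}` attached to a profile. -/
def Problem.posSet (ℓ : Profile N T) : Finset (Fin T) :=
  Finset.univ.filter (fun t => 0 < D.nu ℓ t)

/-- The agent set `N_0` attached to a set `S` of resources. -/
def Problem.N0 (S : Finset (Fin T)) : Finset (Fin N) :=
  Finset.univ.filter (fun n => D.E n - ∑ t ∈ Sᶜ, D.lb n t - ∑ t ∈ S, D.ub n t < 0)

/-- `p` violates the Hoffman inequality given by the sets `S` and `N_0(S)`. -/
def Problem.ViolatesHoffman (S : Finset (Fin T)) : Prop :=
  ∑ n ∈ D.N0 S, D.E n - ∑ t ∈ S, D.p t + ∑ t ∈ S, ∑ n ∈ (D.N0 S)ᶜ, D.ub n t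
    - ∑ t ∈ Sᶜ, ∑ n ∈ D.N0 S, D.lb n t < 0

/-- The infinite sequence `y^(k)` of the alternating projections method started at `y0`. -/
def Problem.apmY (y0 : Profile N T) : ℕ → Profile N T
  | 0 => y0
  | k + 1 => proj D.Y (proj D.X (Problem.apmY y0 k))

/-- The infinite sequence `ℓ^(k+1) = P_X(y^(k))` of the alternating projections method. -/
def Problem.apmX (y0 : Profile N T) (k : ℕ) : Profile N T := proj D.X (D.apmY y0 k)

end Problem

/-- The contraction factor `ρ_{NT}`. -/
def rho (N T : ℕ) : ℝ := 1 - 4 / ((N : ℝ) * ((T : ℝ) + 1) ^ 2 * ((T : ℝ) - 1))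

section SMC

variable {N T : ℕ}

/-- The shares `s_{n,t,m}` of the secure aggregation: the draws for every `m` but the last,
and the remainder for the last `m`. The entries of `draw` at the last `m` are not used. -/
def share (draw : Fin N → Fin T → Fin N → ℝ) (ℓ : Profile N T)
    (n : Fin N) (t : Fin T) (m : Fin N) : ℝ :=
  if m.val + 1 = N then
    ℓ n t - ∑ m' ∈ Finset.univ.filter (fun m' : Fin N => m'.val + 1 ≠ N), draw n t m'
  else draw n t m

/-- The quantity `σ_{n,t} = ∑_m s_{m,t,n}` that agent `n` sends to the operator. -/
def sigma (draw : Fin N → Fin T → Fin N → ℝ) (ℓ : Profile N T) (n : Fin N) (t : Fin T) : ℝ :=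
  ∑ m, share draw ℓ m t n

/-- The aggregate `S = ∑_n σ_n` that the operator computes. -/
def smca (draw : Fin N → Fin T → Fin N → ℝ) (ℓ : Profile N T) (t : Fin T) : ℝ :=
  ∑ n, sigma draw ℓ n t

end SMC

/-- Parameters of the non-intrusive algorithm: the norm `nrm`, the constant `B`, the tolerance
`epsDis`, and a realization `draw k` of the random draws of the `k`-th secure aggregation. -/
structure Params (N T : ℕ) where
  nrm : Seminorm ℝ (Profile N T)
  B : ℝ
  epsDis : ℝ
  draw : ℕ → Fin N → Fin T → Fin N → ℝ

/-- State of the algorithm before a pass through the body of the loop: number `k` of passes made,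
latest `ℓ^(k)` (`none` before the first pass), latest `y^(k)`, current threshold `epsCvg`. -/
structure State (N T : ℕ) where
  k : ℕ
  prev : Option (Profile N T)
  y : Profile N T
  epsCvg : ℝ

/-- What the algorithm returns: `DISAG = true` with the adopted profile, or `DISAG = false` with
the set `T_0` and the number `A_{T_0}`. -/
inductive Outcome (N T : ℕ) where
  | disag (ℓ : Profile N T)
  | cut (T0 : Finset (Fin T)) (A : ℝ)

section Algorithm

variable {N T : ℕ} (D : Problem N T) (P : Params N T)

/-- `ℓ^(k+1)`: each agent projects its row onto its own set. -/
def newL (s : State N T) : Profile N T := WithLp.toLp 2 (fun n => proj (D.Xn n) (s.y n))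

/-- `ν^(k+1)`, computed by the operator from the secure aggregate. -/
def newNu (s : State N T) (t : Fin T) : ℝ :=
  (1 / (N : ℝ)) * (D.p t - smca (P.draw s.k) (newL D s) t)

/-- `y^(k+1)`: each agent adds the correction to its row. -/
def newY (s : State N T) : Profile N T :=
  WithLp.toLp 2 (fun n => WithLp.toLp 2 (fun t => newL D s n t + newNu D P s t))

/-- The stopping test of the loop after the pass; it needs a preceding iterate `ℓ^(k)`. -/
def LoopExit (s : State N T) : Prop :=
  ∃ ℓ, s.prev = some ℓ ∧ P.nrm (newL D s - ℓ) < s.epsCvg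

/-- The set `T_0` computed by the operator. -/
def T0 (s : State N T) : Finset (Fin T) :=
  Finset.univ.filter (fun t => 3 / 2 * P.B * s.epsCvg < newNu D P s t)

/-- The number `A_{T_0}` computed by the operator. -/
def AT0 (s : State N T) : ℝ :=
  ∑ t ∈ T0 D P s, ∑ n, sigma (P.draw s.k) (newL D s) n t

open Classical in
/-- One pass through the body of the loop, followed by the tests. If the loop is left and neither
return is reached, the threshold is halved and the loop is entered again. -/
def step (s : State N T) : State N T ⊕ Outcome N T :=
  if LoopExit D P s then
    if P.nrm (newL D s - newY D P s) ≤ P.epsDis then .inr (.disag (newL D s))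
    else if AT0 D P s - ∑ t ∈ T0 D P s, D.p t < 0 then .inr (.cut (T0 D P s) (AT0 D P s))
    else .inl ⟨s.k + 1, some (newL D s), newY D P s, s.epsCvg / 2⟩
  else .inl ⟨s.k + 1, some (newL D s), newY D P s, s.epsCvg⟩

/-- The execution started at `y0` with threshold `epsCvg`, after `j` passes: a state as long as
the algorithm has not returned, then its outcome. -/
def run (y0 : Profile N T) (epsCvg : ℝ) : ℕ → State N T ⊕ Outcome N T
  | 0 => .inl ⟨0, none, y0, epsCvg⟩
  | j + 1 => match run y0 epsCvg j with
    | .inl s => step D P s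
    | .inr o => .inr o

end Algorithm

end NIAPM

end

open NIAPM

namespace NIAPM

/-! ### Projections onto convex sets and convergence of alternating projections. -/

section Projection

variable {V : Type*} [NormedAddCommGroup V] [InnerProductSpace ℝ V]

/-! The passes of the algorithm are exactly alternating projections between the compact set X and
the affine set Y: secure summation returns the true aggregate whatever the draws, and P_Y adds ν to
each row. Firm nonexpansiveness makes the orbit converge to some `a` with P_X(P_Y(a)) = a
(`exists_tendsto_alternating_proj`).

The quantitative core is `Problem.abs_nu_sub_nu_le`: |ν(ℓ') - ν(a)| ≤ 2(T-1)‖ℓ' - ℓ‖ when ℓ' =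
P_X(P_Y(ℓ)). Each row of `a` maximizes the linear form ν(a) over X_n, and each row of ℓ' maximizes
ν(ℓ') up to a perturbation of size ‖ℓ' - ℓ‖. If ν(ℓ') - ν(a) is larger on S than off S by more than
2‖ℓ' - ℓ‖, an exchange argument shows that S receives at least as much in ℓ' as in `a`, so ν(ℓ') -
ν(a) has nonpositive sum over S. Its total being zero, its values cannot spread far from 0. No
contraction estimate is needed: (1-ρ)⁻¹ already exceeds 2(T-1). Hence in the Frobenius norm every
loop exit has |ν - ν(a)| < Bε, and a cutoff at 3Bε/2 separates positive from nonpositive limit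
values once ε is small.

Termination holds because steps tend to 0, so exits recur and ε is halved repeatedly: either ν(a) =
0 and the residual falls below the tolerance, or some ν(a)_t > 0 eventually enters `T0`. The Hoffman
cut comes from optimality of the rows of `a`: each saturates its upper bounds on S or its lower
bounds off S. -/

theorem isNearest_iff {C : Set V} (hC : Convex ℝ C) {y x : V} :
    IsNearest C y x ↔ x ∈ C ∧ ∀ z ∈ C, inner ℝ (y - x) (z - x) ≤ 0 := by
  constructor
  · rintro ⟨hx, h⟩
    refine ⟨hx, (norm_eq_iInf_iff_real_inner_le_zero hC hx).1 (le_antisymm ?_ ?_)⟩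
    · have : Nonempty C := ⟨⟨x, hx⟩⟩
      exact le_ciInf fun z => h z z.2
    · exact ciInf_le ⟨0, by rintro _ ⟨z, rfl⟩; exact norm_nonneg _⟩ (⟨x, hx⟩ : C)
  · rintro ⟨hx, h⟩
    refine ⟨hx, fun z hz => ?_⟩
    rw [(norm_eq_iInf_iff_real_inner_le_zero hC hx).2 h]
    exact ciInf_le ⟨0, by rintro _ ⟨z, rfl⟩; exact norm_nonneg _⟩ (⟨z, hz⟩ : C)

/-- Firm nonexpansiveness, stated for two separate variational inequalities so that u = v also
yields uniqueness of the projection. -/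
theorem norm_sq_add_le_of_inner_le {u v p q : V} (hp : inner ℝ (u - p) (q - p) ≤ 0)
    (hq : inner ℝ (v - q) (p - q) ≤ 0) :
    ‖p - q‖ ^ 2 + ‖(u - p) - (v - q)‖ ^ 2 ≤ ‖u - v‖ ^ 2 := by
  have e : u - v = (p - q) + ((u - p) - (v - q)) := by abel
  rw [e, norm_add_sq_real]
  have : inner ℝ (p - q) ((u - p) - (v - q))
      = -inner ℝ (u - p) (q - p) - inner ℝ (v - q) (p - q) := by
    rw [inner_sub_right, real_inner_comm (u - p), real_inner_comm (v - q), ← inner_neg_right,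
      neg_sub]
  linarith

variable {C : Set V}

theorem proj_eq_of_inner_le (hC : Convex ℝ C) {y x : V} (hx : x ∈ C)
    (h : ∀ z ∈ C, inner ℝ (y - x) (z - x) ≤ 0) : proj C y = x := by
  have hn : IsNearest C y (proj C y) :=
    Classical.epsilon_spec (p := IsNearest C y) ⟨x, (isNearest_iff hC).2 ⟨hx, h⟩⟩
  obtain ⟨hm, hi⟩ := (isNearest_iff hC).1 hn
  have := norm_sq_add_le_of_inner_le (hi x hx) (h _ hm)
  rw [sub_self, norm_zero] at this
  have h0 : ‖proj C y - x‖ = 0 := by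
    nlinarith [sq_nonneg ‖proj C y - x‖, sq_nonneg ‖(y - proj C y) - (y - x)‖]
  exact sub_eq_zero.1 (norm_eq_zero.1 h0)

variable [CompleteSpace V]

theorem proj_spec (hC : Convex ℝ C) (hcl : IsClosed C) (hne : C.Nonempty) (y : V) :
    proj C y ∈ C ∧ ∀ z ∈ C, inner ℝ (y - proj C y) (z - proj C y) ≤ 0 := by
  obtain ⟨x, hx, h⟩ := exists_norm_eq_iInf_of_complete_convex hne hcl.isComplete hC y
  have h' := (norm_eq_iInf_iff_real_inner_le_zero hC hx).1 h
  rw [proj_eq_of_inner_le hC hx h']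
  exact ⟨hx, h'⟩

theorem norm_proj_sub_proj_sq_add_le (hC : Convex ℝ C) (hcl : IsClosed C) (hne : C.Nonempty)
    (u v : V) :
    ‖proj C u - proj C v‖ ^ 2 + ‖(u - proj C u) - (v - proj C v)‖ ^ 2 ≤ ‖u - v‖ ^ 2 :=
  have hu := proj_spec hC hcl hne u
  have hv := proj_spec hC hcl hne v
  norm_sq_add_le_of_inner_le (hu.2 _ hv.1) (hv.2 _ hu.1)

theorem norm_proj_sub_proj_le (hC : Convex ℝ C) (hcl : IsClosed C) (hne : C.Nonempty)
    (u v : V) : ‖proj C u - proj C v‖ ≤ ‖u - v‖ := by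
  have := norm_proj_sub_proj_sq_add_le hC hcl hne u v
  exact (sq_le_sq₀ (norm_nonneg _) (norm_nonneg _)).1
    (by linarith [sq_nonneg ‖(u - proj C u) - (v - proj C v)‖])

theorem continuous_proj (hC : Convex ℝ C) (hcl : IsClosed C) (hne : C.Nonempty) :
    Continuous (proj C) := by
  refine (LipschitzWith.of_dist_le_mul (K := 1) fun u v => ?_).continuous
  rw [dist_eq_norm, dist_eq_norm, NNReal.coe_one, one_mul]
  exact norm_proj_sub_proj_le hC hcl hne u v

variable {A : Set V}

/-- A point z of A minimizing the distance to C works: for x in A, ‖z - P_C z‖ ≤ ‖x - P_C x‖ ≤ ‖x -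
P_C z‖, so z is the point of A nearest to P_C z. -/
theorem exists_proj_proj_eq_self (hA : IsCompact A) (hAc : Convex ℝ A) (hAne : A.Nonempty)
    (hC : Convex ℝ C) (hcl : IsClosed C) (hne : C.Nonempty) :
    ∃ z ∈ A, proj A (proj C z) = z := by
  have hcont : Continuous fun z : V => ‖z - proj C z‖ :=
    (continuous_id.sub (continuous_proj hC hcl hne)).norm
  obtain ⟨z, hz, hmin⟩ := hA.exists_isMinOn hAne hcont.continuousOn
  refine ⟨z, hz, ?_⟩
  have hn : IsNearest A (proj C z) z := by
    refine ⟨hz, fun x hx => ?_⟩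
    have h1 : ‖z - proj C z‖ ≤ ‖x - proj C x‖ := hmin hx
    have h2 := ((isNearest_iff hC).2 (proj_spec hC hcl hne x)).2 _ (proj_spec hC hcl hne z).1
    rw [norm_sub_rev, norm_sub_rev _ x]
    exact h1.trans h2
  obtain ⟨_, h⟩ := (isNearest_iff hAc).1 hn
  exact proj_eq_of_inner_le hAc hz h

/-- Adding firm nonexpansiveness of both projections leaves two residual differences, whose sum is
minus the step because those of z cancel. The factor 1/2 comes from the parallelogram law. -/
theorem norm_sub_sq_add_le_of_fixed (hA : Convex ℝ A) (hAcl : IsClosed A) (hAne : A.Nonempty)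
    (hC : Convex ℝ C) (hcl : IsClosed C) (hne : C.Nonempty) {z : V}
    (hz : proj A (proj C z) = z) (x : V) :
    ‖proj A (proj C x) - z‖ ^ 2 + ‖proj A (proj C x) - x‖ ^ 2 / 2 ≤ ‖x - z‖ ^ 2 := by
  have h1 := norm_proj_sub_proj_sq_add_le hC hcl hne x z
  have h2 := norm_proj_sub_proj_sq_add_le hA hAcl hAne (proj C x) (proj C z)
  rw [hz] at h2
  have h3 := parallelogram_law_with_norm ℝ ((x - proj C x) - (z - proj C z))
    ((proj C x - proj A (proj C x)) - (proj C z - z))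
  have e : ((x - proj C x) - (z - proj C z)) + ((proj C x - proj A (proj C x)) - (proj C z - z))
      = -(proj A (proj C x) - x) := by abel
  rw [e, norm_neg] at h3
  nlinarith [norm_nonneg (((x - proj C x) - (z - proj C z)) -
    ((proj C x - proj A (proj C x)) - (proj C z - z)))]

/-- Alternating projections between a compact convex set and a closed convex set converge. -/
theorem exists_tendsto_alternating_proj (hA : IsCompact A) (hAc : Convex ℝ A) (hAne : A.Nonempty)
    (hC : Convex ℝ C) (hcl : IsClosed C) (hne : C.Nonempty) {u : ℕ → V} (hu0 : u 0 ∈ A)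
    (hu : ∀ k, u (k + 1) = proj A (proj C (u k))) :
    ∃ a ∈ A, proj A (proj C a) = a ∧ Tendsto u atTop (𝓝 a) := by
  have hAcl := hA.isClosed
  have hstep : ∀ z, proj A (proj C z) = z → ∀ k,
      ‖u (k + 1) - z‖ ^ 2 + ‖u (k + 1) - u k‖ ^ 2 / 2 ≤ ‖u k - z‖ ^ 2 := fun z hz k => by
    rw [hu k]
    exact norm_sub_sq_add_le_of_fixed hAc hAcl hAne hC hcl hne hz (u k)
  have hanti : ∀ z, proj A (proj C z) = z → Antitone fun k => ‖u k - z‖ ^ 2 := fun z hz =>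
    antitone_nat_of_succ_le fun k => by nlinarith [hstep z hz k, sq_nonneg ‖u (k + 1) - u k‖]
  have hconv : ∀ z, proj A (proj C z) = z →
      ∃ c, Tendsto (fun k => ‖u k - z‖ ^ 2) atTop (𝓝 c) := fun z hz =>
    ⟨_, tendsto_atTop_ciInf (hanti z hz) ⟨0, by rintro _ ⟨k, rfl⟩; positivity⟩⟩
  have hmem : ∀ k, u k ∈ A := by
    rintro (_ | k)
    · exact hu0
    · rw [hu k]; exact (proj_spec hAc hAcl hAne _).1
  -- The squared step is at most twice the decrease of the convergent sequence ‖u k - z‖².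
  have hdiff : Tendsto (fun k => u (k + 1) - u k) atTop (𝓝 0) := by
    obtain ⟨z, _, hz⟩ := exists_proj_proj_eq_self hA hAc hAne hC hcl hne
    obtain ⟨c, hc⟩ := hconv z hz
    have h0 : Tendsto (fun k => 2 * (‖u k - z‖ ^ 2 - ‖u (k + 1) - z‖ ^ 2)) atTop (𝓝 0) := by
      simpa using (hc.sub (hc.comp (tendsto_add_atTop_nat 1))).const_mul 2
    have h1 : Tendsto (fun k => ‖u (k + 1) - u k‖ ^ 2) atTop (𝓝 0) :=
      squeeze_zero (fun k => by positivity) (fun k => by linarith [hstep z hz k]) h0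
    rw [tendsto_zero_iff_norm_tendsto_zero]
    simpa using h1.sqrt
  obtain ⟨a, ha, φ, hφ, hlim⟩ := hA.tendsto_subseq hmem
  have hcont : Continuous fun x => proj A (proj C x) :=
    (continuous_proj hAc hAcl hAne).comp (continuous_proj hC hcl hne)
  have hfix : proj A (proj C a) = a := by
    have h1 : Tendsto (fun k => u (φ k + 1) - u (φ k)) atTop (𝓝 (proj A (proj C a) - a)) := by
      have := ((hcont.tendsto a).comp hlim).sub hlim
      simpa [Function.comp_def, hu] using this
    exact sub_eq_zero.1 (tendsto_nhds_unique h1 (hdiff.comp hφ.tendsto_atTop))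
  refine ⟨a, ha, hfix, ?_⟩
  -- The distance to the fixed point `a` converges and vanishes along the subsequence, so the whole
  -- sequence converges.
  obtain ⟨c, hc⟩ := hconv a hfix
  have h0 : Tendsto (fun k => ‖u (φ k) - a‖ ^ 2) atTop (𝓝 0) := by
    simpa using ((hlim.sub_const a).norm).pow 2
  rw [tendsto_nhds_unique (hc.comp hφ.tendsto_atTop) h0] at hc
  rw [tendsto_iff_norm_sub_tendsto_zero]
  simpa using hc.sqrt

end Projection

/-! ### The sets X and Y and their projections. -/

section Geometry

variable {N T : ℕ} (D : Problem N T)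

theorem profile_inner_eq_sum (x y : Profile N T) :
    inner ℝ x y = ∑ n, ∑ t, x n t * y n t := by
  simp [PiLp.inner_apply, mul_comm]

theorem profile_norm_sq_eq_sum (x : Profile N T) : ‖x‖ ^ 2 = ∑ n, ∑ t, x n t ^ 2 := by
  rw [← real_inner_self_eq_norm_sq, profile_inner_eq_sum]
  simp only [sq]

theorem Problem.convex_Xn (n : Fin N) : Convex ℝ (D.Xn n) := by
  intro x hx y hy a b ha hb hab
  refine ⟨?_, fun t => ⟨?_, ?_⟩⟩
  · simp only [PiLp.add_apply, PiLp.smul_apply, smul_eq_mul, Finset.sum_add_distrib,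
      ← Finset.mul_sum, hx.1, hy.1, ← add_mul, hab, one_mul]
  · simp only [PiLp.add_apply, PiLp.smul_apply, smul_eq_mul]
    calc D.lb n t = a * D.lb n t + b * D.lb n t := by rw [← add_mul, hab, one_mul]
      _ ≤ _ := by gcongr; exacts [(hx.2 t).1, (hy.2 t).1]
  · simp only [PiLp.add_apply, PiLp.smul_apply, smul_eq_mul]
    calc _ ≤ a * D.ub n t + b * D.ub n t := by gcongr; exacts [(hx.2 t).2, (hy.2 t).2]
      _ = D.ub n t := by rw [← add_mul, hab, one_mul]

theorem Problem.isClosed_Xn (n : Fin N) : IsClosed (D.Xn n) := by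
  simp only [Problem.Xn, Set.ofPred_and, Set.ofPred_forall]
  refine (isClosed_eq (by fun_prop) continuous_const).inter (isClosed_iInter fun t => ?_)
  exact (isClosed_le continuous_const (by fun_prop)).inter
    (isClosed_le (by fun_prop) continuous_const)

theorem Problem.convex_X : Convex ℝ D.X :=
  fun _ hx _ hy _ _ ha hb hab n => D.convex_Xn n (hx n) (hy n) ha hb hab

theorem Problem.isClosed_X : IsClosed D.X := by
  simp only [Problem.X, Set.ofPred_forall]
  exact isClosed_iInter fun n => (D.isClosed_Xn n).preimage (by fun_prop)

theorem Problem.isCompact_X : IsCompact D.X := by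
  refine Metric.isCompact_of_isClosed_isBounded D.isClosed_X ?_
  refine (Metric.isBounded_closedBall (x := (0 : Profile N T))
    (r := √(∑ n, ∑ t, (|D.lb n t| + |D.ub n t|) ^ 2))).subset fun x hx => ?_
  rw [mem_closedBall_zero_iff]
  refine Real.le_sqrt_of_sq_le ?_
  rw [profile_norm_sq_eq_sum]
  refine Finset.sum_le_sum fun n _ => Finset.sum_le_sum fun t _ => ?_
  obtain ⟨h1, h2⟩ := (hx n).2 t
  refine sq_le_sq' ?_ ?_
  · linarith [neg_abs_le (D.lb n t), abs_nonneg (D.ub n t)]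
  · linarith [le_abs_self (D.ub n t), abs_nonneg (D.lb n t)]

theorem Problem.convex_Y : Convex ℝ D.Y := by
  intro x hx y hy a b ha hb hab t
  simp only [PiLp.add_apply, PiLp.smul_apply, smul_eq_mul, Finset.sum_add_distrib,
      ← Finset.mul_sum, hx t, hy t, ← add_mul, hab, one_mul]

theorem Problem.isClosed_Y : IsClosed D.Y := by
  simp only [Problem.Y, Set.ofPred_forall]
  exact isClosed_iInter fun t => isClosed_eq (by fun_prop) continuous_const

theorem Problem.card_mul_nu (hN : 1 ≤ N) (ℓ : Profile N T) (t : Fin T) :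
    (N : ℝ) * D.nu ℓ t = D.p t - ∑ n, ℓ n t := by
  have : (N : ℝ) ≠ 0 := by positivity
  rw [Problem.nu]; field_simp

/-- The projection onto `Y` adds the correction `ν` to every row. -/
theorem Problem.proj_Y (hN : 1 ≤ N) (ℓ : Profile N T) :
    proj D.Y ℓ = WithLp.toLp 2 (fun n => WithLp.toLp 2 (fun t => ℓ n t + D.nu ℓ t)) := by
  refine proj_eq_of_inner_le D.convex_Y (fun t => ?_) fun z hz => ?_
  · simp [Finset.sum_add_distrib, D.card_mul_nu hN]
  · rw [profile_inner_eq_sum, Finset.sum_comm]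
    refine (Finset.sum_eq_zero fun t _ => ?_).le
    have h : ∑ n, z n t = D.p t := hz t
    simp only [PiLp.sub_apply, sub_add_cancel_left, ← Finset.mul_sum, Finset.sum_sub_distrib,
      Finset.sum_add_distrib, h, Finset.sum_const, Finset.card_univ, Fintype.card_fin,
      nsmul_eq_mul, D.card_mul_nu hN]
    ring

theorem Problem.proj_Y_apply (hN : 1 ≤ N) (ℓ : Profile N T) (n : Fin N) (t : Fin T) :
    proj D.Y ℓ n t = ℓ n t + D.nu ℓ t := by rw [D.proj_Y hN]

theorem Problem.proj_Y_mem (hN : 1 ≤ N) (ℓ : Profile N T) : proj D.Y ℓ ∈ D.Y := fun t => by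
  simp [Finset.sum_add_distrib, D.card_mul_nu hN, D.proj_Y_apply hN]

theorem Problem.nonempty_Xn (hX : D.X.Nonempty) (n : Fin N) : (D.Xn n).Nonempty :=
  hX.elim fun x hx => ⟨x n, hx n⟩

/-- `x` maximizes the linear form `w` over `X_n`. -/
def Problem.Maximizes (n : Fin N) (w : Fin T → ℝ) (x : EuclideanSpace ℝ (Fin T)) : Prop :=
  x ∈ D.Xn n ∧ ∀ z ∈ D.Xn n, ∑ t, w t * (z t - x t) ≤ 0

theorem Problem.proj_Xn_maximizes (hX : D.X.Nonempty) (n : Fin N)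
    (y : EuclideanSpace ℝ (Fin T)) :
    D.Maximizes n (fun t => y t - proj (D.Xn n) y t) (proj (D.Xn n) y) := by
  obtain ⟨h1, h2⟩ := proj_spec (D.convex_Xn n) (D.isClosed_Xn n) (D.nonempty_Xn hX n) y
  refine ⟨h1, fun z hz => ?_⟩
  have := h2 z hz
  simpa [PiLp.inner_apply, mul_comm] using this

/-- The projection onto the product `X` is computed row by row. -/
theorem Problem.proj_X (hX : D.X.Nonempty) (y : Profile N T) :
    proj D.X y = WithLp.toLp 2 (fun n => proj (D.Xn n) (y n)) := by
  refine proj_eq_of_inner_le D.convex_X (fun n => (D.proj_Xn_maximizes hX n (y n)).1)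
    fun z hz => ?_
  rw [profile_inner_eq_sum]
  exact Finset.sum_nonpos fun n _ => (D.proj_Xn_maximizes hX n (y n)).2 (z n) (hz n)

theorem Problem.proj_X_maximizes (hX : D.X.Nonempty) (y : Profile N T) (n : Fin N) :
    D.Maximizes n (fun t => y n t - proj D.X y n t) (proj D.X y n) := by
  rw [D.proj_X hX]
  exact D.proj_Xn_maximizes hX n (y n)

theorem Problem.proj_X_mem (hX : D.X.Nonempty) (y : Profile N T) : proj D.X y ∈ D.X :=
  fun n => (D.proj_X_maximizes hX y n).1

/-! ### Exchange arguments and the gap estimate. -/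

variable {D}

/-- A maximizer admits no improving transfer between two resources. -/
theorem Problem.Maximizes.le_of_transfer {n : Fin N} {w : Fin T → ℝ}
    {x : EuclideanSpace ℝ (Fin T)} (h : D.Maximizes n w x) {s t : Fin T}
    (hs : x s < D.ub n s) (ht : D.lb n t < x t) : w s ≤ w t := by
  rcases eq_or_ne s t with rfl | hst
  · exact le_rfl
  -- The largest amount that can be moved from t to s without leaving the bounds.
  set η := min (D.ub n s - x s) (x t - D.lb n t) with hη
  have hη0 : 0 < η := lt_min (by linarith) (by linarith)
  have h1 : η ≤ D.ub n s - x s := min_le_left _ _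
  have h2 : η ≤ x t - D.lb n t := min_le_right _ _
  have := h.2 (WithLp.toLp 2 fun r => x r + η * ((if r = s then 1 else 0) - if r = t then 1 else 0))
    ⟨by simp [Finset.sum_add_distrib, ← Finset.mul_sum, h.1.1], fun r => by
      have hr := h.1.2 r
      by_cases hrs : r = s
      · subst hrs
        simp only [if_true, if_neg hst]
        constructor <;> linarith
      · by_cases hrt : r = t
        · subst hrt
          simp only [if_true, if_neg hrs]
          constructor <;> linarith
        · simpa [hrs, hrt] using hr⟩
  simp only [add_sub_cancel_left, mul_sub, mul_ite, mul_one,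
    mul_zero, Finset.sum_sub_distrib, Finset.sum_ite_eq', Finset.mem_univ, if_true] at this
  nlinarith

/-- Raising the weights on `S` relative to the other ones does not lower the share of `S`. -/
theorem Problem.Maximizes.sum_le_sum {n : Fin N} {w w' : Fin T → ℝ}
    {x x' : EuclideanSpace ℝ (Fin T)} (h : D.Maximizes n w x) (h' : D.Maximizes n w' x')
    {S : Finset (Fin T)} (hS : ∀ s ∈ S, ∀ t ∉ S, w' t - w t < w' s - w s) :
    ∑ t ∈ S, x t ≤ ∑ t ∈ S, x' t := by
  by_contra! hlt
  obtain ⟨s, hs, hxs⟩ := Finset.exists_lt_of_sum_lt hlt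
  have e := Finset.sum_add_sum_compl S fun t => x t
  have e' := Finset.sum_add_sum_compl S fun t => x' t
  rw [h.1.1] at e
  rw [h'.1.1] at e'
  -- Both rows have the same total, so what S loses its complement gains. Optimality of x gives w t
  -- ≤ w s, that of x' gives w' s ≤ w' t.
  obtain ⟨t, ht, hxt⟩ := Finset.exists_lt_of_sum_lt
    (show ∑ t ∈ Sᶜ, x t < ∑ t ∈ Sᶜ, x' t by linarith)
  have h1 := h.le_of_transfer (hxt.trans_le (h'.1.2 t).2) ((h'.1.2 s).1.trans_lt hxs)
  have h2 := h'.le_of_transfer (hxs.trans_le (h.1.2 s).2) ((h.1.2 t).1.trans_lt hxt)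
  linarith [hS s hs t (Finset.mem_compl.1 ht)]

/-- Climb in levels of height c: at least j + 1 indices lie at or below jc. If none were gained
between jc and (j+1)c, the indices above would form a gap set with positive sum. Level T - 1
contains every index. -/
theorem le_of_forall_gap_sum_nonpos {μ : Fin T → ℝ} {c : ℝ} (hc : 0 ≤ c) (hμ : ∑ t, μ t = 0)
    (h : ∀ S : Finset (Fin T), (∀ s ∈ S, ∀ t ∉ S, μ t + c < μ s) → ∑ t ∈ S, μ t ≤ 0)
    (t : Fin T) : μ t ≤ ((T : ℝ) - 1) * c := by
  have hcard : ∀ j : ℕ, j + 1 ≤ T → j + 1 ≤ (Finset.univ.filter fun t => μ t ≤ j * c).card := by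
    intro j
    induction j with
    | zero =>
      intro _
      rw [zero_add, Nat.one_le_iff_ne_zero, ← Nat.pos_iff_ne_zero, Finset.card_pos]
      by_contra hne
      rw [Finset.not_nonempty_iff_eq_empty, Finset.filter_eq_empty_iff] at hne
      have : 0 < ∑ t, μ t :=
        Finset.sum_pos (fun t _ => by simpa using hne (Finset.mem_univ t)) ⟨t, Finset.mem_univ t⟩
      linarith
    | succ j ih =>
      intro hj
      have ih := ih (by omega)
      by_contra! hlt
      have hsub : (Finset.univ.filter fun t => μ t ≤ j * c) ⊆
          Finset.univ.filter fun t => μ t ≤ (j + 1 : ℕ) * c := by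
        intro t ht
        simp only [Finset.mem_filter, Finset.mem_univ, true_and] at ht ⊢
        push_cast
        linarith
      have heq := Finset.eq_of_subset_of_card_le hsub (by omega)
      have hpos : ∀ s ∈ (Finset.univ.filter fun t => μ t ≤ j * c)ᶜ, (j + 1) * c < μ s := by
        intro s hs
        rw [heq] at hs
        simpa using hs
      have hne : ((Finset.univ.filter fun t => μ t ≤ j * c)ᶜ).Nonempty := by
        rw [← Finset.card_pos, Finset.card_compl, Fintype.card_fin, heq]
        omega
      have h1 := h (Finset.univ.filter fun t => μ t ≤ j * c)ᶜ fun s hs t ht => by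
        have h1 := hpos s hs
        have h2 : μ t ≤ j * c := by simpa using ht
        linarith
      have h2 : 0 < ∑ t ∈ (Finset.univ.filter fun t => μ t ≤ j * c)ᶜ, μ t :=
        Finset.sum_pos (fun s hs => lt_of_le_of_lt (by positivity) (hpos s hs)) hne
      linarith
  have hT : 1 ≤ T := by have := t.2; omega
  have h1 := hcard (T - 1) (by omega)
  have h2 := Finset.eq_univ_of_card (Finset.univ.filter fun t => μ t ≤ (T - 1 : ℕ) * c)
    (le_antisymm (Finset.card_le_univ _) (by rw [Fintype.card_fin]; omega))
  have h3 := (Finset.filter_eq_self.1 h2) t (Finset.mem_univ t)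
  rwa [Nat.cast_sub hT, Nat.cast_one] at h3

theorem abs_le_of_forall_gap_sum_nonpos {μ : Fin T → ℝ} {c : ℝ} (hc : 0 ≤ c)
    (hμ : ∑ t, μ t = 0)
    (h : ∀ S : Finset (Fin T), (∀ s ∈ S, ∀ t ∉ S, μ t + c < μ s) → ∑ t ∈ S, μ t ≤ 0)
    (t : Fin T) : |μ t| ≤ ((T : ℝ) - 1) * c := by
  refine abs_le'.2 ⟨le_of_forall_gap_sum_nonpos hc hμ h t,
    le_of_forall_gap_sum_nonpos (μ := fun t => -μ t) hc (by simp [hμ]) (fun S hS => ?_) t⟩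
  -- A gap set of -μ is the complement of a gap set of μ.
  have h1 := h Sᶜ fun s hs t ht => by
    have := hS t (by simpa using ht) s (by simpa using hs)
    linarith
  have h2 := Finset.sum_add_sum_compl S μ
  rw [Finset.sum_neg_distrib]
  linarith

/-- Subtracting the mean of a column does not increase its sum of squares. -/
theorem abs_sub_mean_le_norm (δ : Profile N T) (n : Fin N) (t : Fin T) :
    |δ n t - 1 / (N : ℝ) * ∑ m, δ m t| ≤ ‖δ‖ := by
  refine abs_le_of_sq_le_sq ?_ (norm_nonneg _)
  have hN : (N : ℝ) ≠ 0 := Nat.cast_ne_zero.2 (by have := n.2; omega)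
  set m := 1 / (N : ℝ) * ∑ m, δ m t with hm
  have hNm : (N : ℝ) * m = ∑ m, δ m t := by rw [hm]; field_simp
  calc (δ n t - m) ^ 2 ≤ ∑ i, (δ i t - m) ^ 2 :=
        Finset.single_le_sum (f := fun i => (δ i t - m) ^ 2) (fun i _ => sq_nonneg _)
          (Finset.mem_univ n)
    _ = ∑ i, δ i t ^ 2 - N * m ^ 2 := by
        simp only [sub_sq, Finset.sum_add_distrib, Finset.sum_sub_distrib, ← Finset.sum_mul,
          ← Finset.mul_sum, ← hNm, Finset.sum_const, Finset.card_univ, Fintype.card_fin,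
          nsmul_eq_mul]
        ring
    _ ≤ ∑ i, δ i t ^ 2 := by nlinarith [sq_nonneg m, Nat.cast_nonneg (α := ℝ) N]
    _ ≤ ∑ i, ∑ r, δ i r ^ 2 := by
        gcongr with i _
        exact Finset.single_le_sum (f := fun r => δ i r ^ 2) (fun r _ => sq_nonneg _)
          (Finset.mem_univ t)
    _ = ‖δ‖ ^ 2 := (profile_norm_sq_eq_sum δ).symm

/-! ### Fixed points of the alternating projections. -/

variable (D)

theorem Problem.sum_nu_eq_zero (hp : ∑ t, D.p t = ∑ n, D.E n) {ℓ : Profile N T}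
    (hℓ : ℓ ∈ D.X) : ∑ t, D.nu ℓ t = 0 := by
  simp only [Problem.nu, ← Finset.mul_sum, Finset.sum_sub_distrib]
  rw [Finset.sum_comm, Finset.sum_congr rfl fun n _ => (hℓ n).1, hp, sub_self, mul_zero]

/-- At a fixed point, P_Y(a) - a is ν(a) in every row, so the variational inequality of P_X involves
one weight common to all agents. -/
theorem Problem.maximizes_of_fixed (hN : 1 ≤ N) (hX : D.X.Nonempty) {a : Profile N T}
    (ha : proj D.X (proj D.Y a) = a) (n : Fin N) : D.Maximizes n (D.nu a) (a n) := by
  have := D.proj_X_maximizes hX (proj D.Y a) n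
  rw [ha] at this
  simpa [D.proj_Y_apply hN] using this

/-- The length of an alternating projections step bounds the distance of the correction from
its limit value. -/
theorem Problem.abs_nu_sub_nu_le (hN : 1 ≤ N) (hX : D.X.Nonempty)
    (hp : ∑ t, D.p t = ∑ n, D.E n) {a : Profile N T} (ha : proj D.X (proj D.Y a) = a)
    (ℓ : Profile N T) (t : Fin T) :
    |D.nu (proj D.X (proj D.Y ℓ)) t - D.nu a t|
      ≤ ((T : ℝ) - 1) * (2 * ‖proj D.X (proj D.Y ℓ) - ℓ‖) := by
  set ℓ' := proj D.X (proj D.Y ℓ) with hℓ'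
  have haX : a ∈ D.X := ha ▸ D.proj_X_mem hX _
  refine abs_le_of_forall_gap_sum_nonpos (μ := fun t => D.nu ℓ' t - D.nu a t) (by positivity)
    ?_ (fun S hS => ?_) t
  · rw [Finset.sum_sub_distrib, D.sum_nu_eq_zero hp (D.proj_X_mem hX _),
      D.sum_nu_eq_zero hp haX, sub_self]
  · have hrow : ∀ n, ∑ t ∈ S, a n t ≤ ∑ t ∈ S, ℓ' n t := fun n => by
      refine (D.maximizes_of_fixed hN hX ha n).sum_le_sum
        (D.proj_X_maximizes hX (proj D.Y ℓ) n) fun s hs t ht => ?_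
      -- The weight maximized by row n of ℓ' is ν(ℓ') plus a column-centred entry of ℓ - ℓ', bounded
      -- by the step length. Comparing two resources costs this bound twice.
      have hq : ∀ r, proj D.Y ℓ n r - ℓ' n r =
          D.nu ℓ' r + ((ℓ - ℓ') n r - 1 / (N : ℝ) * ∑ m, (ℓ - ℓ') m r) := fun r => by
        rw [D.proj_Y_apply hN]
        simp only [Problem.nu, PiLp.sub_apply, Finset.sum_sub_distrib]
        ring
      rw [← hℓ', hq, hq]
      have h1 := abs_le.1 (abs_sub_mean_le_norm (ℓ - ℓ') n s)
      have h2 := abs_le.1 (abs_sub_mean_le_norm (ℓ - ℓ') n t)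
      rw [norm_sub_rev] at h1 h2
      linarith [hS s hs t ht, h1.1, h2.2]
    have hN0 : (0 : ℝ) < N := by positivity
    have hsum : (N : ℝ) * ∑ t ∈ S, (D.nu ℓ' t - D.nu a t)
        = ∑ n, (∑ t ∈ S, a n t - ∑ t ∈ S, ℓ' n t) := by
      simp only [Finset.mul_sum, mul_sub, D.card_mul_nu hN, Finset.sum_sub_distrib]
      rw [Finset.sum_comm (γ := Fin N), Finset.sum_comm (γ := Fin N)]
      ring
    have : (N : ℝ) * ∑ t ∈ S, (D.nu ℓ' t - D.nu a t) ≤ 0 :=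
      hsum ▸ Finset.sum_nonpos fun n _ => sub_nonpos.2 (hrow n)
    exact nonpos_of_mul_nonpos_right this hN0

/-- The share of S in each row of `a` is at least the smaller of its two capacity bounds, and `N0`
records which one is smaller. Summing over agents gives a lower bound for the S-aggregate of `a`,
which is below that of p since ν > 0 on S. -/
theorem Problem.violatesHoffman_of_fixed (hN : 1 ≤ N) (hX : D.X.Nonempty) {a : Profile N T}
    (ha : proj D.X (proj D.Y a) = a) (hne : (D.posSet a).Nonempty) :
    D.ViolatesHoffman (D.posSet a) := by
  set S := D.posSet a with hS
  have hpos : ∀ t, t ∈ S ↔ 0 < D.nu a t := fun t => by simp [hS, Problem.posSet]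
  have hlt : ∑ n, ∑ t ∈ S, a n t < ∑ t ∈ S, D.p t := by
    rw [Finset.sum_comm]
    refine Finset.sum_lt_sum_of_nonempty hne fun t ht => ?_
    have := D.card_mul_nu hN a t
    have h0 := (hpos t).1 ht
    have hN0 : (0 : ℝ) < N := by positivity
    nlinarith [mul_pos hN0 h0]
  -- Otherwise a transfer from outside S, where ν ≤ 0, into S, where ν > 0, would improve the row.
  have hdich : ∀ n, (∀ t ∈ S, D.ub n t ≤ a n t) ∨ ∀ t ∈ Sᶜ, a n t ≤ D.lb n t := fun n => by
    by_contra! ⟨⟨s, hs, hs'⟩, t, ht, ht'⟩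
    have := (D.maximizes_of_fixed hN hX ha n).le_of_transfer hs' ht'
    have h1 := (hpos s).1 hs
    have h2 := mt (hpos t).2 (Finset.mem_compl.1 ht)
    linarith
  have hX' : ∀ n, a n ∈ D.Xn n := fun n => (D.maximizes_of_fixed hN hX ha n).1
  have hrow : ∀ n, (if n ∈ D.N0 S then D.E n - ∑ t ∈ Sᶜ, D.lb n t else ∑ t ∈ S, D.ub n t)
      ≤ ∑ t ∈ S, a n t := fun n => by
    have e := Finset.sum_add_sum_compl S fun t => a n t
    rw [(hX' n).1] at e
    have h1 : ∑ t ∈ S, a n t ≤ ∑ t ∈ S, D.ub n t := Finset.sum_le_sum fun t _ => ((hX' n).2 t).2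
    have h2 : ∑ t ∈ Sᶜ, D.lb n t ≤ ∑ t ∈ Sᶜ, a n t :=
      Finset.sum_le_sum fun t _ => ((hX' n).2 t).1
    split_ifs with hn
    · simp only [Problem.N0, Finset.mem_filter, Finset.mem_univ, true_and] at hn
      rcases hdich n with h | h <;> linarith [Finset.sum_le_sum h]
    · simp only [Problem.N0, Finset.mem_filter, Finset.mem_univ, true_and] at hn
      rcases hdich n with h | h <;> linarith [Finset.sum_le_sum h]
  have htot := Finset.sum_le_sum fun n (_ : n ∈ Finset.univ) => hrow n
  rw [Finset.sum_ite, Finset.filter_mem_eq_inter, Finset.univ_inter, Finset.filter_notMem_eq_sdiff,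
    ← Finset.compl_eq_univ_sdiff, Finset.sum_sub_distrib] at htot
  rw [Problem.ViolatesHoffman, Finset.sum_comm (s := S), Finset.sum_comm (s := Sᶜ)]
  linarith

/-- Testing the optimality of the rows against a point of X ∩ Y and summing gives N ∑ ν² ≤ 0. -/
theorem Problem.nu_eq_zero_of_fixed (hN : 1 ≤ N) (hX : D.X.Nonempty) {a : Profile N T}
    (ha : proj D.X (proj D.Y a) = a) (hne : (D.X ∩ D.Y).Nonempty) (t : Fin T) :
    D.nu a t = 0 := by
  obtain ⟨z, hzX, hzY⟩ := hne
  have hN0 : (0 : ℝ) < N := by positivity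
  have h : ∑ n, ∑ t, D.nu a t * (z n t - a n t) ≤ 0 :=
    Finset.sum_nonpos fun n _ => (D.maximizes_of_fixed hN hX ha n).2 _ (hzX n)
  rw [Finset.sum_comm] at h
  have e : ∀ t, ∑ n, D.nu a t * (z n t - a n t) = N * D.nu a t ^ 2 := fun t => by
    have h1 : ∑ n, z n t = D.p t := hzY t
    rw [← Finset.mul_sum, Finset.sum_sub_distrib, h1, ← D.card_mul_nu hN]
    ring
  simp only [e] at h
  have h0 := (Finset.sum_eq_zero_iff_of_nonneg fun t _ => by positivity).1
    (le_antisymm h (Finset.sum_nonneg fun t _ => by positivity)) t (Finset.mem_univ t)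
  rcases mul_eq_zero.1 h0 with h0 | h0
  · exact absurd h0 hN0.ne'
  · exact pow_eq_zero_iff two_ne_zero |>.1 h0

theorem Problem.mem_Y_of_nu_eq_zero (hN : 1 ≤ N) {a : Profile N T} (h : ∀ t, D.nu a t = 0) :
    a ∈ D.Y := fun t => by
  have := D.card_mul_nu hN a t
  rw [h t, mul_zero] at this
  linarith

theorem Problem.continuous_nu (t : Fin T) : Continuous fun ℓ : Profile N T => D.nu ℓ t := by
  unfold Problem.nu
  fun_prop

end Geometry

/-! ### Executions of the algorithm and termination. -/

section Execution

variable {N T : ℕ} {D : Problem N T} {P : Params N T}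

/-- The last share is the remainder, so the shares of each entry add up to it for any draws. -/
theorem sum_sigma (hN : 1 ≤ N) (draw : Fin N → Fin T → Fin N → ℝ) (ℓ : Profile N T) (t : Fin T) :
    ∑ n, sigma draw ℓ n t = ∑ n, ℓ n t := by
  simp only [sigma]
  rw [Finset.sum_comm]
  refine Finset.sum_congr rfl fun n _ => ?_
  have hlast : Finset.univ.filter (fun m : Fin N => m.val + 1 = N) = {⟨N - 1, by omega⟩} := by
    ext m
    simp only [Finset.mem_filter, Finset.mem_univ, true_and, Finset.mem_singleton, Fin.ext_iff]
    omega
  simp only [share, Finset.sum_ite, hlast, Finset.sum_singleton]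
  ring

theorem newL_eq (hX : D.X.Nonempty) (s : State N T) : newL D s = proj D.X s.y :=
  (D.proj_X hX s.y).symm

theorem newNu_eq (hN : 1 ≤ N) (s : State N T) (t : Fin T) :
    newNu D P s t = D.nu (newL D s) t := by
  simp only [newNu, smca, sum_sigma hN, Problem.nu]

theorem newY_eq (hN : 1 ≤ N) (s : State N T) : newY D P s = proj D.Y (newL D s) := by
  simp only [newY, newNu_eq hN, D.proj_Y hN]

theorem AT0_eq (hN : 1 ≤ N) (s : State N T) :
    AT0 D P s = ∑ t ∈ T0 D P s, ∑ n, newL D s n t := by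
  simp only [AT0, sum_sigma hN]

/-- Here (1-ρ)⁻¹ = N(T+1)²(T-1)/4, and N(T+1)² ≥ 9 > 8. -/
theorem two_mul_lt_of_inv_one_sub_rho_lt (hN : 1 ≤ N) (hT : 2 ≤ T) {B : ℝ}
    (hB : (1 - rho N T)⁻¹ < B) : 2 * ((T : ℝ) - 1) < B := by
  refine lt_of_le_of_lt ?_ hB
  have hN' : (1 : ℝ) ≤ N := by exact_mod_cast hN
  have hT' : (2 : ℝ) ≤ T := by exact_mod_cast hT
  rw [rho, sub_sub_cancel, inv_div, le_div_iff₀ (by norm_num)]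
  have h1 : (9 : ℝ) ≤ ((T : ℝ) + 1) ^ 2 := by nlinarith
  have h2 : (8 : ℝ) ≤ N * ((T : ℝ) + 1) ^ 2 := by nlinarith
  nlinarith

/-- The operator's set `T_0` is nonempty exactly when its test succeeds. -/
theorem AT0_sub_neg_iff (hN : 1 ≤ N) {s : State N T} (hB : 0 < P.B) (hs : 0 < s.epsCvg) :
    AT0 D P s - ∑ t ∈ T0 D P s, D.p t < 0 ↔ (T0 D P s).Nonempty := by
  constructor
  · intro h
    by_contra hne
    rw [Finset.not_nonempty_iff_eq_empty] at hne
    simp [AT0, hne] at h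
  · intro h
    rw [AT0_eq hN, sub_neg]
    refine Finset.sum_lt_sum_of_nonempty h fun t ht => ?_
    simp only [T0, Finset.mem_filter, Finset.mem_univ, true_and, newNu_eq hN] at ht
    have h0 : 0 < D.nu (newL D s) t := lt_trans (by positivity) ht
    have h1 := D.card_mul_nu hN (newL D s) t
    have h2 : (0 : ℝ) < N := by positivity
    linarith [mul_pos h2 h0]

theorem Problem.apmX_succ (y0 : Profile N T) (k : ℕ) :
    D.apmX y0 (k + 1) = proj D.X (proj D.Y (D.apmX y0 k)) := rfl

theorem step_eq_disag {s : State N T} {ℓ : Profile N T} (h : step D P s = .inr (.disag ℓ)) :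
    LoopExit D P s ∧ ℓ = newL D s ∧ P.nrm (newL D s - newY D P s) ≤ P.epsDis := by
  unfold step at h
  split_ifs at h with h1 h2 h3 <;> simp_all

theorem step_eq_cut {s : State N T} {S : Finset (Fin T)} {A : ℝ}
    (h : step D P s = .inr (.cut S A)) :
    LoopExit D P s ∧ S = T0 D P s ∧ A = AT0 D P s ∧ A - ∑ t ∈ S, D.p t < 0 := by
  unfold step at h
  split_ifs at h with h1 h2 h3
  all_goals simp only [Sum.inr.injEq, Outcome.cut.injEq, reduceCtorEq] at h
  obtain ⟨rfl, rfl⟩ := h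
  exact ⟨h1, rfl, rfl, h3⟩

theorem step_eq_inl {s s' : State N T} (h : step D P s = .inl s') :
    s'.k = s.k + 1 ∧ s'.prev = some (newL D s) ∧ s'.y = newY D P s ∧
      ((LoopExit D P s ∧ ¬ P.nrm (newL D s - newY D P s) ≤ P.epsDis ∧
        ¬ AT0 D P s - ∑ t ∈ T0 D P s, D.p t < 0 ∧ s'.epsCvg = s.epsCvg / 2) ∨
      (¬ LoopExit D P s ∧ s'.epsCvg = s.epsCvg)) := by
  unfold step at h
  split_ifs at h with h1 h2 h3
  all_goals
    simp only [Sum.inl.injEq] at h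
    subst h
    simp_all

variable {y0 : Profile N T} {ε : ℝ}

theorem run_succ_of_inl {j : ℕ} {s : State N T} (h : run D P y0 ε j = .inl s) :
    run D P y0 ε (j + 1) = step D P s := by
  simp only [run, h]

theorem exists_step_of_run_eq_inr {j : ℕ} {o : Outcome N T} (h : run D P y0 ε j = .inr o) :
    ∃ i s, run D P y0 ε i = .inl s ∧ step D P s = .inr o := by
  induction j with
  | zero => simp [run] at h
  | succ j ih =>
    rcases hr : run D P y0 ε j with s | o'
    · exact ⟨j, s, hr, by rw [← run_succ_of_inl hr, h]⟩
    · simp only [run, hr] at h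
      exact ih (by rw [hr, h])

/-- The states reached by the algorithm carry the alternating projections iterates. -/
theorem run_eq_inl (hN : 1 ≤ N) (hX : D.X.Nonempty) (hε : 0 < ε) {j : ℕ} {s : State N T}
    (h : run D P y0 ε j = .inl s) :
    s.y = D.apmY y0 j ∧ (∀ ℓ, s.prev = some ℓ → ∃ i, j = i + 1 ∧ ℓ = D.apmX y0 i) ∧
      (0 < j → s.prev = some (D.apmX y0 (j - 1))) ∧ 0 < s.epsCvg := by
  induction j generalizing s with
  | zero =>
    simp only [run, Sum.inl.injEq] at h
    subst h
    simp [Problem.apmY, hε]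
  | succ j ih =>
    rcases hr : run D P y0 ε j with s' | o'
    · obtain ⟨hy, -, -, hpos⟩ := ih hr
      rw [run_succ_of_inl hr] at h
      obtain ⟨-, hprev, hy', he⟩ := step_eq_inl h
      have hL : newL D s' = D.apmX y0 j := by rw [newL_eq hX, hy]; rfl
      refine ⟨?_, fun ℓ hℓ => ⟨j, rfl, ?_⟩, fun _ => ?_, ?_⟩
      · rw [hy', newY_eq hN, hL]; rfl
      · rw [hprev, Option.some.injEq] at hℓ
        rw [← hℓ, hL]
      · rw [hprev, hL, Nat.add_sub_cancel]
      · rcases he with ⟨-, -, -, he⟩ | ⟨-, he⟩ <;> rw [he]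
        · positivity
        · exact hpos
    · simp [run, hr] at h

theorem newL_of_run (hN : 1 ≤ N) (hX : D.X.Nonempty) (hε : 0 < ε) {j : ℕ} {s : State N T}
    (h : run D P y0 ε j = .inl s) : newL D s = D.apmX y0 j := by
  rw [newL_eq hX, (run_eq_inl hN hX hε h).1]; rfl

theorem loopExit_succ_iff (hN : 1 ≤ N) (hX : D.X.Nonempty) (hε : 0 < ε) {j : ℕ} {s : State N T}
    (h : run D P y0 ε (j + 1) = .inl s) :
    LoopExit D P s ↔ P.nrm (D.apmX y0 (j + 1) - D.apmX y0 j) < s.epsCvg := by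
  have hprev := (run_eq_inl hN hX hε h).2.2.1 (Nat.succ_pos j)
  rw [LoopExit, hprev, newL_of_run hN hX hε h]
  simp

/-- At an exit of the loop the correction is close to its limit value. -/
theorem abs_nu_sub_nu_lt_of_loopExit (hN : 1 ≤ N) (hT : 2 ≤ T) (hX : D.X.Nonempty)
    (hp : ∑ t, D.p t = ∑ n, D.E n) (hB : (1 - rho N T)⁻¹ < P.B) (hε : 0 < ε)
    (hnorm : ∀ ℓ, P.nrm ℓ = ‖ℓ‖) {a : Profile N T} (ha : proj D.X (proj D.Y a) = a)
    {j : ℕ} {s : State N T} (h : run D P y0 ε j = .inl s) (hexit : LoopExit D P s) (t : Fin T) :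
    |newNu D P s t - D.nu a t| < P.B * s.epsCvg := by
  obtain ⟨-, hprev, -, hpos⟩ := run_eq_inl hN hX hε h
  obtain ⟨ℓ, hℓ, hlt⟩ := id hexit
  obtain ⟨i, rfl, -⟩ := hprev ℓ hℓ
  rw [loopExit_succ_iff hN hX hε h, hnorm, Problem.apmX_succ] at hexit
  rw [newNu_eq hN, newL_of_run hN hX hε h, Problem.apmX_succ]
  have h1 := D.abs_nu_sub_nu_le hN hX hp ha (D.apmX y0 i) t
  have h2 := two_mul_lt_of_inv_one_sub_rho_lt hN hT hB
  have hT' : (2 : ℝ) ≤ T := by exact_mod_cast hT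
  nlinarith [norm_nonneg (proj D.X (proj D.Y (D.apmX y0 i)) - D.apmX y0 i)]

/-- A finite convex function on a finite-dimensional space is continuous. -/
theorem continuous_seminorm (p : Seminorm ℝ (Profile N T)) : Continuous p := by
  rw [← continuousOn_univ]
  exact p.convexOn.continuousOn isOpen_univ

/-- If the iterates converge, the loop cannot be run forever. -/
theorem exists_run_eq_inr (hN : 1 ≤ N) (hX : D.X.Nonempty)
    (hp : ∑ t, D.p t = ∑ n, D.E n) (hB : 0 < P.B) (hdis : 0 < P.epsDis) (hε : 0 < ε)
    {a : Profile N T} (haX : a ∈ D.X) (hlim : Tendsto (D.apmX y0) atTop (𝓝 a)) :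
    ∃ j o, run D P y0 ε j = .inr o := by
  by_contra! hno
  have hst : ∀ j, ∃ s, run D P y0 ε j = .inl s := fun j => by
    rcases hr : run D P y0 ε j with s | o
    · exact ⟨s, rfl⟩
    · exact absurd hr (hno j o)
  choose st hst using hst
  have hL : ∀ j, newL D (st j) = D.apmX y0 j := fun j => newL_of_run hN hX hε (hst j)
  have hpos : ∀ j, 0 < (st j).epsCvg := fun j => (run_eq_inl hN hX hε (hst j)).2.2.2
  have hstep : ∀ j, step D P (st j) = .inl (st (j + 1)) := fun j => by
    rw [← run_succ_of_inl (hst j), hst]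
  have hhalf : ∀ j, LoopExit D P (st j) → (st (j + 1)).epsCvg = (st j).epsCvg / 2 :=
    fun j hj => by
      rcases (step_eq_inl (hstep j)).2.2.2 with h | h
      · exact h.2.2.2
      · exact absurd hj h.1
  have hkeep : ∀ j, ¬ LoopExit D P (st j) → (st (j + 1)).epsCvg = (st j).epsCvg :=
    fun j hj => by
      rcases (step_eq_inl (hstep j)).2.2.2 with h | h
      · exact absurd h.1 hj
      · exact h.2
  have hanti : Antitone fun j => (st j).epsCvg := antitone_nat_of_succ_le fun j => by
    by_cases hj : LoopExit D P (st j)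
    · rw [hhalf j hj]; linarith [hpos j]
    · rw [hkeep j hj]
  have hdiff : Tendsto (fun j => P.nrm (D.apmX y0 (j + 1) - D.apmX y0 j)) atTop (𝓝 0) := by
    have h1 : Tendsto (fun j => D.apmX y0 (j + 1) - D.apmX y0 j) atTop (𝓝 0) := by
      simpa using (hlim.comp (tendsto_add_atTop_nat 1)).sub hlim
    simpa [Function.comp_def] using ((continuous_seminorm P.nrm).tendsto 0).comp h1
  -- Without further exits the threshold would stay at a fixed positive value while the steps tend
  -- to 0.
  have hexit : ∀ K, ∃ j ≥ K, LoopExit D P (st j) := fun K => by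
    by_contra! hK
    have hc : ∀ i, (st (K + i)).epsCvg = (st K).epsCvg := fun i => by
      induction i with
      | zero => rfl
      | succ i ih => rw [← ih, ← hkeep _ (hK (K + i) (by omega))]; rfl
    obtain ⟨m, hm⟩ := eventually_atTop.1 (hdiff.eventually_lt_const (hpos K))
    refine hK (K + m + 1) (by omega) ((loopExit_succ_iff hN hX hε (hst _)).2 ?_)
    have := hc (m + 1)
    rw [← add_assoc] at this
    rw [this]
    exact hm _ (by omega)
  have hsmall : ∀ m : ℕ, ∃ j, (st j).epsCvg ≤ (st 0).epsCvg * (1 / 2) ^ m := fun m => by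
    induction m with
    | zero => exact ⟨0, by simp⟩
    | succ m ih =>
      obtain ⟨j, hj⟩ := ih
      obtain ⟨i, hi, he⟩ := hexit j
      refine ⟨i + 1, ?_⟩
      rw [hhalf i he, pow_succ]
      linarith [hanti hi]
  have hnot : ∀ j, LoopExit D P (st j) →
      P.epsDis < P.nrm (D.apmX y0 j - proj D.Y (D.apmX y0 j)) ∧ ¬ (T0 D P (st j)).Nonempty :=
    fun j hj => by
      rcases (step_eq_inl (hstep j)).2.2.2 with ⟨-, h1, h2, -⟩ | h
      · rw [newY_eq hN, hL, not_le] at h1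
        exact ⟨h1, mt (AT0_sub_neg_iff hN hB (hpos j)).2 h2⟩
      · exact absurd hj h.1
  -- If ν(a) = 0 the residual tends to 0. Otherwise, since ν(a) sums to zero, it has a positive
  -- entry, which ends up in `T0`.
  by_cases hν : ∀ t, D.nu a t = 0
  · have hfix : a - proj D.Y a = 0 := by
      ext n t
      simp [D.proj_Y_apply hN, hν]
    have hc : Continuous fun ℓ : Profile N T => P.nrm (ℓ - proj D.Y ℓ) :=
      (continuous_seminorm P.nrm).comp (continuous_id.sub
        (continuous_proj D.convex_Y D.isClosed_Y ⟨_, D.proj_Y_mem hN a⟩))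
    have h0 : Tendsto (fun j => P.nrm (D.apmX y0 j - proj D.Y (D.apmX y0 j))) atTop (𝓝 0) := by
      simpa [Function.comp_def, hfix] using (hc.tendsto a).comp hlim
    obtain ⟨m, hm⟩ := eventually_atTop.1 (h0.eventually_lt_const hdis)
    obtain ⟨j, hj, he⟩ := hexit m
    exact lt_asymm (hm j hj) (hnot j he).1
  · push Not at hν
    obtain ⟨t1, ht1⟩ := hν
    obtain ⟨t, -, ht⟩ := Finset.exists_pos_of_sum_zero_of_exists_nonzero (fun t => D.nu a t)
      (D.sum_nu_eq_zero hp haX) ⟨t1, Finset.mem_univ _, ht1⟩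
    have h0 : Tendsto (fun j => D.nu (D.apmX y0 j) t) atTop (𝓝 (D.nu a t)) :=
      ((D.continuous_nu t).tendsto a).comp hlim
    obtain ⟨m, hm⟩ := eventually_atTop.1 (h0.eventually_const_lt (half_lt_self ht))
    -- Once ε ≤ ν(a)_t/(3B), the cutoff 3Bε/2 is at most ν(a)_t/2, which the iterates eventually
    -- exceed.
    have hδ : 0 < D.nu a t / (3 * P.B) / (st 0).epsCvg := by
      have := hpos 0
      positivity
    obtain ⟨r, hr⟩ := exists_pow_lt_of_lt_one hδ (show (1 / 2 : ℝ) < 1 by norm_num)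
    obtain ⟨i, hi⟩ := hsmall r
    obtain ⟨j, hj, he⟩ := hexit (max i m)
    refine (hnot j he).2 ⟨t, ?_⟩
    simp only [T0, Finset.mem_filter, Finset.mem_univ, true_and, newNu_eq hN, hL]
    refine lt_of_le_of_lt ?_ (hm j (le_of_max_le_right hj))
    rw [lt_div_iff₀ (hpos 0)] at hr
    have h1 : (st j).epsCvg ≤ D.nu a t / (3 * P.B) :=
      (hanti (le_of_max_le_left hj)).trans (hi.trans (by linarith))
    rw [le_div_iff₀ (by positivity)] at h1
    linarith

end Execution

end NIAPM

open NIAPM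

/-! ### The main theorem. -/

theorem mainTheorem3 {N T : ℕ} (hN : 1 ≤ N) (hT : 2 ≤ T)
    (D : Problem N T) (hX : D.X.Nonempty) (hp : ∑ t, D.p t = ∑ n, D.E n)
    (P : Params N T) (hnrm : ∀ ℓ, P.nrm ℓ = 0 → ℓ = 0)
    (hB : (1 - rho N T)⁻¹ < P.B) (hdis : 0 < P.epsDis)
    (y0 : Profile N T) (epsCvg : ℝ) (hcvg : 0 < epsCvg) :
    -- the algorithm terminates
    (∃ j o, run D P y0 epsCvg j = .inr o) ∧
    -- it returns an approximate disaggregation or an inequality violated by `p`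
    (∀ j ℓ, run D P y0 epsCvg j = .inr (.disag ℓ) →
      ℓ ∈ D.X ∧ P.nrm (ℓ - proj D.Y ℓ) ≤ P.epsDis) ∧
    (∀ j S A, run D P y0 epsCvg j = .inr (.cut S A) →
      A < ∑ t ∈ S, D.p t ∧ ∃ ℓ ∈ D.X, A = ∑ t ∈ S, ∑ n, ℓ n t) ∧
    -- the limit orbit of the alternating projections
    ∃ ℓinf ∈ D.X, ∃ yinf ∈ D.Y,
      Tendsto (D.apmX y0) atTop (𝓝 ℓinf) ∧ Tendsto (D.apmY y0) atTop (𝓝 yinf) ∧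
      -- for the Euclidean norm
      ((∀ ℓ, P.nrm ℓ = ‖ℓ‖) →
        -- a feasible problem is never declared infeasible
        ((D.X ∩ D.Y).Nonempty → ∃ j ℓ, run D P y0 epsCvg j = .inr (.disag ℓ)) ∧
        -- whenever the loop is left with a threshold that is small enough, `T_0` is the limit
        -- set, and if the problem is infeasible, the algorithm returns and the cut is violated
        (∀ j s, run D P y0 epsCvg j = .inl s → LoopExit D P s →
          (∀ t, D.nu ℓinf t ≠ 0 → P.B * s.epsCvg < 2 / 5 * |D.nu ℓinf t|) →
          T0 D P s = D.posSet ℓinf ∧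
          (D.X ∩ D.Y = ∅ →
            AT0 D P s < ∑ t ∈ D.posSet ℓinf, D.p t ∧
            D.ViolatesHoffman (D.posSet ℓinf) ∧
            (step D P s = .inr (.disag (newL D s)) ∨
              step D P s = .inr (.cut (D.posSet ℓinf) (AT0 D P s)))))) := by

  have hB0 : 0 < P.B := by
    have hT' : (2 : ℝ) ≤ T := by exact_mod_cast hT
    linarith [two_mul_lt_of_inv_one_sub_rho_lt hN hT hB]
  have hYne : D.Y.Nonempty := ⟨_, D.proj_Y_mem hN y0⟩
  obtain ⟨a, haX, ha, hlim⟩ := exists_tendsto_alternating_proj D.isCompact_X D.convex_X hX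
    D.convex_Y D.isClosed_Y hYne (u := D.apmX y0) (D.proj_X_mem hX _) (D.apmX_succ y0)
  have hterm := exists_run_eq_inr hN hX hp hB0 hdis hcvg haX hlim
  refine ⟨hterm, fun j ℓ h => ?_, fun j S A h => ?_, a, haX, proj D.Y a, D.proj_Y_mem hN a, hlim,
    ?_, fun hnorm => ⟨fun hXY => ?_, fun j s h hexit hsmall => ?_⟩⟩
  · obtain ⟨i, s, -, hs⟩ := exists_step_of_run_eq_inr h
    obtain ⟨-, rfl, hle⟩ := step_eq_disag hs
    exact ⟨newL_eq hX s ▸ D.proj_X_mem hX _, newY_eq (P := P) hN s ▸ hle⟩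
  · obtain ⟨i, s, -, hs⟩ := exists_step_of_run_eq_inr h
    obtain ⟨-, rfl, rfl, hlt⟩ := step_eq_cut hs
    exact ⟨sub_neg.1 hlt, newL D s, newL_eq hX s ▸ D.proj_X_mem hX _, AT0_eq hN s⟩
  · rw [← tendsto_add_atTop_iff_nat 1]
    exact ((continuous_proj D.convex_Y D.isClosed_Y hYne).tendsto a).comp hlim
  · obtain ⟨j, ℓ | ⟨S, A⟩, hj⟩ := hterm
    · exact ⟨j, ℓ, hj⟩
    · obtain ⟨i, s, hi, hs⟩ := exists_step_of_run_eq_inr hj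
      obtain ⟨hexit, rfl, rfl, hlt⟩ := step_eq_cut hs
      have hpos := (run_eq_inl hN hX hcvg hi).2.2.2
      obtain ⟨t, ht⟩ := (AT0_sub_neg_iff hN hB0 hpos).1 hlt
      simp only [T0, Finset.mem_filter, Finset.mem_univ, true_and] at ht
      have hlt := abs_nu_sub_nu_lt_of_loopExit hN hT hX hp hB hcvg hnorm ha hi hexit t
      -- In the feasible case ν(a) = 0, so |ν| < Bε at the exit and no entry can pass the cutoff
      -- 3Bε/2.
      rw [D.nu_eq_zero_of_fixed hN hX ha hXY, sub_zero] at hlt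
      nlinarith [le_abs_self (newNu D P s t), mul_pos hB0 hpos]
  · have hpos := (run_eq_inl hN hX hcvg h).2.2.2
    -- A nonpositive limit value keeps ν below Bε; a positive one exceeds 5Bε/2 by the smallness
    -- assumption, so ν exceeds 5Bε/2 - Bε = 3Bε/2.
    have hT0 : T0 D P s = D.posSet a := by
      refine Finset.filter_congr fun t _ => ?_
      have hlt := abs_lt.1 (abs_nu_sub_nu_lt_of_loopExit hN hT hX hp hB hcvg hnorm ha h hexit t)
      constructor
      · intro ht
        by_contra! hle
        linarith [mul_pos hB0 hpos]
      · intro ht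
        have := hsmall t ht.ne'
        rw [abs_of_pos ht] at this
        linarith
    refine ⟨hT0, fun hempty => ?_⟩
    have hne : (D.posSet a).Nonempty := by
      have hν : ∃ t, D.nu a t ≠ 0 := by
        by_contra! hν
        exact (hempty ▸ ⟨haX, D.mem_Y_of_nu_eq_zero hN hν⟩ : a ∈ (∅ : Set (Profile N T)))
      obtain ⟨t1, ht1⟩ := hν
      obtain ⟨t, -, ht⟩ := Finset.exists_pos_of_sum_zero_of_exists_nonzero (fun t => D.nu a t)
        (D.sum_nu_eq_zero hp haX) ⟨t1, Finset.mem_univ _, ht1⟩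
      exact ⟨t, Finset.mem_filter.2 ⟨Finset.mem_univ _, ht⟩⟩
    have hA : AT0 D P s - ∑ t ∈ T0 D P s, D.p t < 0 :=
      (AT0_sub_neg_iff hN hB0 hpos).2 (hT0 ▸ hne)
    refine ⟨hT0 ▸ sub_neg.1 hA, D.violatesHoffman_of_fixed hN hX ha hne, ?_⟩
    rw [← hT0]
    unfold step
    split_ifs with h2
    · exact Or.inl rfl
    · exact Or.inr rfl
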